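/- Let $C$ be a bivariate copula and let $\overline{C}(a,b)=1-a-b+C(a,b)$ be its joint survival function, so that $\overline{C}(a,b)=\mathbb{P}(U_1>a,U_2>b)$ for $(U_1,U_2)\sim C$. Write $\bar u=1-u$, $u\vee v=\max(u,v)$ and $u\wedge v=\min(u,v)$. For $x,y\ge 0$ the logarithm is extended by $\log(x/y)=-\infty$ if $x=0<y$, $\log(x/y)=\infty$ if $x>0=y$, and $\log(x/y)=0$ if $x=y=0$. Let $(U_{11},U_{21}),(U_{12},U_{22}),\ldots$ be independent random vectors, all with joint distribution function $C$ on $[0,1]^2$. For $0<u\le 0.5$ put $$\alpha(u)=\log\frac{\mathbb{P}(F_1(U_{11})>1-u,\,F_2(U_{21})>1-u)}{\mathbb{P}(F_1(U_{11})\le u,\,F_2(U_{21})\le u)},$$ where $F_1,F_2$ are the (uniform) marginal distribution functions of $U_{11},U_{21}$, so that $\alpha(u)=\log\{\overline{C}(\bar u,\bar u)/C(u,u)\}$. For $n\ge 1$ put $$T_L(u)=\frac1n\sum_{i=1}^n\mathbf{1}(U_{1i}\le u,\,U_{2i}\le u),\qquad T_U(u)=\frac1n\sum_{i=1}^n\mathbf{1}(U_{1i}\ge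 1-u,\,U_{2i}\ge 1-u),$$ $$\hat\alpha(u)=\log\frac{T_U(u)}{T_L(u)},\qquad \mathbb{A}_n(u)=\sqrt n\,\{\hat\alpha(u)-\alpha(u)\}.$$ Let $I$ be the set of all $u\in(0,0.5]$ with $C(u,u)>0$ and $\overline{C}(\bar u,\bar u)>0$ (so $I=(0,0.5]$ if both are positive for every $u\in(0,0.5]$). Then there exists a centred real Gaussian process $\{G(u):u\in I\}$ with covariance function $$\sigma(u,v)=\frac{C(u\vee v,u\vee v)+\overline{C}(\bar u\wedge\bar v,\bar u\wedge\bar v)}{C(u\vee v,u\vee v)\cdot\overline{C}(\bar u\wedge\bar v,\bar u\wedge\bar v)},\qquad u,v\in I,$$ and, as $n\to\infty$, the process $\{\mathbb{A}_n(u):u\in I\}$ converges weakly to $\{G(u):u\in I\}$, as random elements of the space $[-\infty,\infty]^I$ of all paths with the topology of pointwise convergence: $\mathbb{E}\,\Phi(\mathbb{A}_n)\to\mathbb{E}\,\Phi(G)$ for every bounded continuous $\Phi:[-\infty,\infty]^I\to\mathbb{R}$. Equivalently, for all $m$ and $u_1,\ldots,u_m\in I$, the vector $(\mathbb{A}_n(u_1),\ldots,\mathbb{A}_n(u_m))$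 converges in distribution to $(G(u_1),\ldots,G(u_m))$. -/

import Mathlib

open MeasureTheory ProbabilityTheory Filter Topology

noncomputable section

/-- `C` is a bivariate copula: on the unit square it is grounded, has uniform margins and is
2-increasing. Values of `C` outside `[0,1]²` play no role. -/
structure IsCopula (C : ℝ → ℝ → ℝ) : Prop where
  zero_left : ∀ b ∈ Set.Icc (0 : ℝ) 1, C 0 b = 0
  zero_right : ∀ a ∈ Set.Icc (0 : ℝ) 1, C a 0 = 0
  one_left : ∀ b ∈ Set.Icc (0 : ℝ) 1, C 1 b = b
  one_right : ∀ a ∈ Set.Icc (0 : ℝ) 1, C a 1 = a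
  two_increasing : ∀ a a' b b' : ℝ, 0 ≤ a → a ≤ a' → a' ≤ 1 → 0 ≤ b → b ≤ b' → b' ≤ 1 →
    0 ≤ C a' b' - C a' b - C a b' + C a b

/-- The joint survival function `C̄(a,b) = 1 - a - b + C(a,b)` of a copula `C`; for
`(U₁,U₂) ∼ C` this is `ℙ(U₁ > a, U₂ > b)`. In particular `C̄(1-u,1-u) = 2u - 1 + C(1-u,1-u)`. -/
def survival (C : ℝ → ℝ → ℝ) (a b : ℝ) : ℝ := 1 - a - b + C a b

/-- The extended logarithm `log (x / y)` of a quotient of nonnegative numbers: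
`-∞` if `x = 0 < y`, `∞` if `y = 0 < x`, and `0` if `x = y = 0`. -/
def logRatio (x y : ℝ) : EReal :=
  if x = 0 ∧ y = 0 then 0
  else if y = 0 then ⊤
  else if x = 0 then ⊥
  else ((Real.log (x / y) : ℝ) : EReal)

section

variable {Ω : Type*} [MeasurableSpace Ω]

/-- The tail asymmetry measure of a random vector `X = (X₁,X₂)` with margins `F₁, F₂`:
`α(u) = log (ℙ(F₁(X₁) > 1-u, F₂(X₂) > 1-u) / ℙ(F₁(X₁) ≤ u, F₂(X₂) ≤ u))`. -/
def tailAlpha (P : Measure Ω) (X : Ω → ℝ × ℝ) (u : ℝ) : EReal :=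
  logRatio
    (P.real {ω | 1 - u < cdf (P.map fun ω' => (X ω').1) (X ω).1 ∧
      1 - u < cdf (P.map fun ω' => (X ω').2) (X ω).2})
    (P.real {ω | cdf (P.map fun ω' => (X ω').1) (X ω).1 ≤ u ∧
      cdf (P.map fun ω' => (X ω').2) (X ω).2 ≤ u})

/-- `U 0, U 1, …` is an iid sequence of random vectors with joint distribution function `C`
on the unit square. -/
structure IsIIDSample (P : Measure Ω) (C : ℝ → ℝ → ℝ) (U : ℕ → Ω → ℝ × ℝ) : Prop where
  measurable : ∀ i, Measurable (U i)
  indep : iIndepFun U P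
  law : ∀ i, ∀ a ∈ Set.Icc (0 : ℝ) 1, ∀ b ∈ Set.Icc (0 : ℝ) 1,
    P.real {ω | (U i ω).1 ≤ a ∧ (U i ω).2 ≤ b} = C a b

open Classical in
/-- `T_L(u) = n⁻¹ ∑ 𝟏(U₁ᵢ ≤ u, U₂ᵢ ≤ u)`, for the first `n` sample points. -/
def lowerFreq (U : ℕ → Ω → ℝ × ℝ) (n : ℕ) (u : ℝ) (ω : Ω) : ℝ :=
  (1 / (n : ℝ)) * ∑ i ∈ Finset.range n, if (U i ω).1 ≤ u ∧ (U i ω).2 ≤ u then (1 : ℝ) else 0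

open Classical in
/-- `T_U(u) = n⁻¹ ∑ 𝟏(U₁ᵢ ≥ 1-u, U₂ᵢ ≥ 1-u)`, for the first `n` sample points. -/
def upperFreq (U : ℕ → Ω → ℝ × ℝ) (n : ℕ) (u : ℝ) (ω : Ω) : ℝ :=
  (1 / (n : ℝ)) *
    ∑ i ∈ Finset.range n, if 1 - u ≤ (U i ω).1 ∧ 1 - u ≤ (U i ω).2 then (1 : ℝ) else 0

/-- The sample analogue `α̂(u) = log (T_U(u) / T_L(u))`. -/
def alphaHat (U : ℕ → Ω → ℝ × ℝ) (n : ℕ) (u : ℝ) (ω : Ω) : EReal :=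
  logRatio (upperFreq U n u ω) (lowerFreq U n u ω)

/-- `𝔸ₙ(u) = √n (α̂(u) - α(u))`, where `α` is the measure of the common distribution of the
sample. It takes the values `±∞` where an empirical tail frequency vanishes. -/
def alphaProcess (P : Measure Ω) (U : ℕ → Ω → ℝ × ℝ) (n : ℕ) (u : ℝ) (ω : Ω) : EReal :=
  ((Real.sqrt (n : ℝ) : ℝ) : EReal) * (alphaHat U n u ω - tailAlpha P (U 0) u)

/-- Weak convergence, as `n → ∞`, of processes `A n` indexed by `T` to a process `G`, as random
elements of the path space of all functions `T → [-∞,∞]` with the topology of pointwise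
convergence: `𝔼 F(A n) → 𝔼 F(G)` for every bounded continuous functional `F` of the path. Taking
`F` to depend on finitely many coordinates gives weak convergence of all finite-dimensional
distributions. -/
structure ConvergesWeakly {T Ω' : Type*} [MeasurableSpace Ω']
    (P : Measure Ω) (A : ℕ → T → Ω → EReal) (Q : Measure Ω') (G : T → Ω' → EReal) : Prop where
  aemeasurable : ∀ n t, AEMeasurable (A n t) P
  aemeasurable_limit : ∀ t, AEMeasurable (G t) Q
  integrable : ∀ F : BoundedContinuousFunction (T → EReal) ℝ, ∀ n,
    Integrable (fun ω => F fun t => A n t ω) P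
  integrable_limit : ∀ F : BoundedContinuousFunction (T → EReal) ℝ,
    Integrable (fun ω => F fun t => G t ω) Q
  tendsto : ∀ F : BoundedContinuousFunction (T → EReal) ℝ,
    Tendsto (fun n => ∫ ω, F (fun t => A n t ω) ∂P) atTop (𝓝 (∫ ω, F (fun t => G t ω) ∂Q))

end

/-- The indices `0 < u ≤ 1/2` at which `C(u,u)` and `C̄(1-u,1-u)` are both positive, i.e. at which
`α(u)` is a finite logarithm and the limiting covariance is defined. -/
def indexSet (C : ℝ → ℝ → ℝ) : Set ℝ :=
  {u | 0 < u ∧ u ≤ 1 / 2 ∧ 0 < C u u ∧ 0 < survival C (1 - u) (1 - u)}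

/-- The covariance function `σ(u,v)`. -/
def limitCov (C : ℝ → ℝ → ℝ) (u v : ℝ) : ℝ :=
  (C (max u v) (max u v) + survival C (min (1 - u) (1 - v)) (min (1 - u) (1 - v))) /
    (C (max u v) (max u v) * survival C (min (1 - u) (1 - v)) (min (1 - u) (1 - v)))

end

/-!
The proof is the delta method for the logarithm, applied to the multivariate central limit theorem.

For a sample point `x` let `influence C u x` be `𝟏(x ∈ upper corner) / C̄(1-u,1-u)` minus
`𝟏(x ∈ lower corner) / C(u,u)`. It is bounded and centred under the copula. At levels up to `1/2`
an upper and a lower corner are almost surely disjoint, and corners of the same kind are nested, so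
that the covariances of the influence functions are exactly `limitCov C`
(`IsCopula.integral_influence_mul`).

Hence `limitCov C u v` is an inner product in `L²(P)`, and the limit process is obtained from an
isometric embedding of this Hilbert space into a space of centred Gaussian variables
(`exists_gaussian_linearIsometry`); no extension theorem for projective families is needed.

By Chebyshev's inequality the squared deviation of an empirical frequency from its mean is of
order `1 / n`, so the quadratic error in the expansion of `log` remains negligible after
multiplication by `√n` (`tendsto_measureReal_log_empFreq_remainder`). Thus `𝔸ₙ(u)` differs from
the normalized sum of the influence functions by a term that tends to zero in probability, except
on the event that a frequency vanishes, where `𝔸ₙ(u)` may be infinite; the probability of this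
event tends to zero. The normalized sums converge by the scalar central limit theorem and the
Cramér–Wold device (`tendstoInDistribution_inv_sqrt_mul_sum_pi`).

Convergence of the finite-dimensional distributions is enough for the path space with the topology
of pointwise convergence: by compactness, a continuous function on a product of copies of
`[-∞, ∞]` is a uniform limit of functions of finitely many coordinates
(`exists_finset_forall_abs_sub_lt`). This also makes such functionals measurable when the index set
is uncountable.
-/

/-! ### Gaussian processes indexed by a Hilbert space -/

/-- The characteristic function at a fixed point depends continuously on a random variable
in `L²`. -/
lemma continuous_charFun_map_Lp {Ω : Type*} [MeasurableSpace Ω] (μ : Measure Ω)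
    [IsProbabilityMeasure μ] (s : ℝ) :
    Continuous fun f : Lp ℝ 2 μ => charFun (μ.map f) s := by
  refine continuous_iff_seqContinuous.2 fun f g hfg => ?_
  have h : TendstoInDistribution (fun n => (f n : Ω → ℝ)) atTop g (fun _ => μ) μ :=
    (tendstoInMeasure_of_tendsto_Lp hfg).tendstoInDistribution
      fun n => (Lp.aestronglyMeasurable (f n)).aemeasurable
  exact ProbabilityMeasure.tendsto_iff_tendsto_charFun.1 h.tendsto s

lemma charFun_map_sum_infinitePi_gaussianReal {ι : Type*} (s : Finset ι) (c : ι → ℝ) (t : ℝ) :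
    charFun ((Measure.infinitePi fun _ : ι => gaussianReal 0 1).map
      fun x => ∑ i ∈ s, c i * x i) t = Complex.exp (-(t ^ 2 * ∑ i ∈ s, c i ^ 2 : ℝ) / 2) := by
  have hind : iIndepFun (fun (i : ι) (x : ι → ℝ) => c i * x i)
      (Measure.infinitePi fun _ : ι => gaussianReal 0 1) :=
    iIndepFun_infinitePi (X := fun i x => c i * x) fun i => by fun_prop
  have hm (i : ι) : Measurable fun x : ι → ℝ => c i * x i := (measurable_pi_apply i).const_mul _
  rw [(hind.restrict _).charFun_map_fun_finsetSum_eq_prod fun i _ => (hm i).aemeasurable]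
  have h (i : ι) : charFun ((Measure.infinitePi fun _ : ι => gaussianReal 0 1).map
      fun x => c i * x i) t = Complex.exp (-(t ^ 2 * c i ^ 2 : ℝ) / 2) := by
    rw [charFun_map_mul_comp (f := fun x : ι → ℝ => x i) (measurable_pi_apply i).aemeasurable]
    have := (measurePreserving_eval_infinitePi (fun _ : ι => gaussianReal 0 1) i).map_eq
    rw [show (fun x : ι → ℝ => x i) = Function.eval i from rfl, this, charFun_gaussianReal]
    congr 1
    push_cast
    simp
    ring
  simp only [Finset.prod_apply, h, ← Complex.exp_sum]
  congr 1
  push_cast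
  rw [← Finset.sum_div, Finset.mul_sum, Finset.sum_neg_distrib]

/-- A Hilbert space embeds isometrically into the `L²` space of a probability measure, in such a
way that every vector becomes a centred Gaussian random variable. -/
theorem exists_gaussian_linearIsometry (H : Type*) [NormedAddCommGroup H]
    [InnerProductSpace ℝ H] [CompleteSpace H] :
    ∃ (Λ : Set H) (γ : Measure (Λ → ℝ)) (W : H →ₗᵢ[ℝ] Lp ℝ 2 γ), IsProbabilityMeasure γ ∧
      ∀ h, γ.map (W h) = gaussianReal 0 (‖h‖ ^ 2).toNNReal := by
  classical
  obtain ⟨Λ, b, -⟩ := exists_hilbertBasis ℝ H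
  set γ : Measure (Λ → ℝ) := Measure.infinitePi fun _ => gaussianReal 0 1 with hγ
  have hlaw (i : Λ) : HasLaw (fun x : Λ → ℝ => x i) (gaussianReal 0 1) γ :=
    (measurePreserving_eval_infinitePi (fun _ : Λ => gaussianReal 0 1) i).hasLaw
  have hmem (i : Λ) : MemLp (fun x : Λ → ℝ => x i) 2 γ := (hlaw i).hasGaussianLaw.memLp_two
  let ξ (i : Λ) : Lp ℝ 2 γ := (hmem i).toLp _
  have hξ : Orthonormal ℝ ξ := by
    rw [orthonormal_iff_ite]
    intro i j
    have h1 : inner ℝ (ξ i) (ξ j) = ∫ x, x i * x j ∂γ := by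
      rw [L2.inner_def]
      refine integral_congr_ae ?_
      filter_upwards [(hmem i).coeFn_toLp, (hmem j).coeFn_toLp] with x hi hj
      simp [ξ, hi, hj, mul_comm]
    have h0 (i : Λ) : ∫ x, x i ∂γ = 0 := by
      rw [(hlaw i).integral_eq, integral_id_gaussianReal]
    rw [h1]
    split_ifs with hij
    · subst hij
      have hv := (hlaw i).variance_eq
      rw [variance_eq_integral (hlaw i).aemeasurable, h0, variance_id_gaussianReal] at hv
      simpa [sq] using hv
    · have hind : iIndepFun (fun (i : Λ) (x : Λ → ℝ) => x i) γ :=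
        iIndepFun_infinitePi (X := fun _ x => x) fun i => by fun_prop
      rw [(hind.indepFun hij).integral_fun_mul_eq_mul_integral
        (measurable_pi_apply i).aestronglyMeasurable (measurable_pi_apply j).aestronglyMeasurable,
        h0, zero_mul]
  let W : H →ₗᵢ[ℝ] Lp ℝ 2 γ :=
    hξ.orthogonalFamily.linearIsometry.comp b.repr.toLinearIsometry
  have hWb (i : Λ) : W (b i) = ξ i := by
    simp [W, b.repr_self, OrthogonalFamily.linearIsometry_apply_single]
  refine ⟨Λ, γ, W, inferInstance, fun h => ?_⟩
  have hcf (t : ℝ) : charFun (γ.map (W h)) t = Complex.exp (-(t ^ 2 * ‖h‖ ^ 2 : ℝ) / 2) := by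
    have hcl : IsClosed {h : H | charFun (γ.map (W h)) t =
        Complex.exp (-(t ^ 2 * ‖h‖ ^ 2 : ℝ) / 2)} :=
      isClosed_eq ((continuous_charFun_map_Lp γ t).comp W.continuous) (by fun_prop)
    have hspan : (Submodule.span ℝ (Set.range b) : Set H) ⊆ {h : H | charFun (γ.map (W h)) t =
        Complex.exp (-(t ^ 2 * ‖h‖ ^ 2 : ℝ) / 2)} := by
      intro h hh
      obtain ⟨c, rfl⟩ := Finsupp.mem_span_range_iff_exists_finsupp.1 hh
      have hae : (W (c.sum fun i a => a • b i) : (Λ → ℝ) → ℝ) =ᵐ[γ]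
          fun x => ∑ i ∈ c.support, c i * x i := by
        simp only [Finsupp.sum, map_sum, map_smul, hWb]
        refine (Lp.coeFn_finsetSum _ _).trans ?_
        have h2 : ∀ᵐ x ∂γ, ∀ i ∈ c.support, (c i • ξ i : Lp ℝ 2 γ) x = c i * x i := by
          rw [Finset.eventually_all]
          intro i _
          filter_upwards [Lp.coeFn_smul (c i) (ξ i), (hmem i).coeFn_toLp] with x h3 h4
          simp [h3, ξ, h4]
        filter_upwards [h2] with x hx
        rw [Finset.sum_apply]
        exact Finset.sum_congr rfl hx
      have hnorm : ‖c.sum fun i a => a • b i‖ ^ 2 = ∑ i ∈ c.support, c i ^ 2 := by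
        rw [← real_inner_self_eq_norm_sq, Finsupp.sum, b.orthonormal.inner_sum]
        simp [sq]
      simp only [Set.mem_ofPred_eq]
      rw [Measure.map_congr hae, charFun_map_sum_infinitePi_gaussianReal, hnorm]
    have hd : Dense (Submodule.span ℝ (Set.range b) : Set H) :=
      Submodule.dense_iff_topologicalClosure_eq_top.2 b.dense_span
    have : h ∈ closure (Submodule.span ℝ (Set.range b) : Set H) := hd h
    exact hcl.closure_subset_iff.2 hspan this
  have : IsProbabilityMeasure (γ.map (W h)) :=
    Measure.isProbabilityMeasure_map (Lp.aestronglyMeasurable _).aemeasurable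
  refine Measure.ext_of_charFun (funext fun t => ?_)
  rw [hcf, charFun_gaussianReal]
  congr 1
  simp
  ring

/-- Every family `h` of vectors of a Hilbert space is the covariance structure of a centred
Gaussian process: there is a probability measure on the paths under which each linear combination
of coordinates is Gaussian with the variance prescribed by `h`. -/
theorem exists_measure_map_sum_eq_gaussianReal {H T : Type*} [NormedAddCommGroup H]
    [InnerProductSpace ℝ H] [CompleteSpace H] (h : T → H) :
    ∃ Q : Measure (T → ℝ), IsProbabilityMeasure Q ∧ ∀ (s : Finset T) (c : T → ℝ),
      Q.map (fun x => ∑ t ∈ s, c t * x t) =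
        gaussianReal 0 (‖∑ t ∈ s, c t • h t‖ ^ 2).toNNReal := by
  obtain ⟨Λ, γ, W, hγ, hW⟩ := exists_gaussian_linearIsometry H
  have hm : Measurable fun (ω : Λ → ℝ) (t : T) => W (h t) ω :=
    measurable_pi_lambda _ fun t => (Lp.stronglyMeasurable _).measurable
  refine ⟨γ.map fun ω t => W (h t) ω, Measure.isProbabilityMeasure_map hm.aemeasurable,
    fun s c => ?_⟩
  rw [← hW, Measure.map_map (by fun_prop) hm]
  refine Measure.map_congr ?_
  simp only [map_sum, map_smul]
  refine EventuallyEq.trans ?_ (Lp.coeFn_finsetSum _ _).symm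
  have h2 : ∀ᵐ x ∂γ, ∀ t ∈ s, (c t • W (h t) : Lp ℝ 2 γ) x = c t * W (h t) x := by
    rw [Finset.eventually_all]
    intro t _
    filter_upwards [Lp.coeFn_smul (c t) (W (h t))] with x h3
    simp [h3]
  filter_upwards [h2] with x hx
  rw [Finset.sum_apply]
  exact (Finset.sum_congr rfl hx).symm

section

variable {H T : Type*} [NormedAddCommGroup H] [InnerProductSpace ℝ H] {h : T → H}
  {Q : Measure (T → ℝ)}

/-- If all linear combinations of coordinates are centred Gaussian, the coordinate process is
Gaussian. -/
lemma isGaussianProcess_of_map_sum (hQ : ∀ (s : Finset T) (c : T → ℝ),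
    Q.map (fun x => ∑ t ∈ s, c t * x t) = gaussianReal 0 (‖∑ t ∈ s, c t • h t‖ ^ 2).toNNReal) :
    IsGaussianProcess (fun (t : T) (x : T → ℝ) => x t) Q := by
  classical
  refine ⟨fun s => ⟨⟨fun L => ?_⟩⟩⟩
  let c (t : T) : ℝ := if ht : t ∈ s then L (Pi.single ⟨t, ht⟩ 1) else 0
  have hL (x : T → ℝ) : L (s.restrict x) = ∑ t ∈ s, c t * x t := by
    rw [← Finset.sum_coe_sort]
    conv_lhs => rw [← Finset.univ_sum_single (s.restrict x)]
    rw [map_sum]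
    refine Finset.sum_congr rfl fun t _ => ?_
    have : (Pi.single t (s.restrict x t) : s → ℝ) = x t • Pi.single t 1 := by
      rw [← Pi.single_smul]
      simp
    rw [this, map_smul]
    simp [c, mul_comm]
  have hmap : (Q.map fun x => s.restrict x).map L =
      gaussianReal 0 (‖∑ t ∈ s, c t • h t‖ ^ 2).toNNReal := by
    rw [Measure.map_map (by fun_prop) (by fun_prop), ← hQ]
    congr 1
    exact funext hL
  change (Q.map fun x => s.restrict x).map L = _
  rw [hmap]
  have h1 : ∫ x, L x ∂(Q.map fun x => s.restrict x) = 0 := by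
    rw [← integral_id_gaussianReal (μ := 0), ← hmap,
      integral_map (φ := L) (by fun_prop) (by fun_prop)]
  have h2 : Var[L; Q.map fun x => s.restrict x] = ‖∑ t ∈ s, c t • h t‖ ^ 2 := by
    have := variance_id_gaussianReal (μ := 0) (v := (‖∑ t ∈ s, c t • h t‖ ^ 2).toNNReal)
    rw [← hmap, variance_map (by fun_prop) (by fun_prop)] at this
    rw [← Real.coe_toNNReal (‖∑ t ∈ s, c t • h t‖ ^ 2) (by positivity), ← this]
    rfl
  have h1' : ∫ x, L x ∂(Q.map fun ω => s.restrict fun t => ω t) = 0 := h1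
  have h2' : Var[L; Q.map fun ω => s.restrict fun t => ω t] = ‖∑ t ∈ s, c t • h t‖ ^ 2 := h2
  rw [h1', h2']

lemma hasLaw_eval_of_map_sum (hQ : ∀ (s : Finset T) (c : T → ℝ),
    Q.map (fun x => ∑ t ∈ s, c t * x t) = gaussianReal 0 (‖∑ t ∈ s, c t • h t‖ ^ 2).toNNReal)
    (t : T) : HasLaw (fun x : T → ℝ => x t) (gaussianReal 0 (‖h t‖ ^ 2).toNNReal) Q :=
  ⟨(measurable_pi_apply t).aemeasurable, by simpa using hQ {t} 1⟩

lemma covariance_eval_of_map_sum [IsProbabilityMeasure Q] (hQ : ∀ (s : Finset T) (c : T → ℝ),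
    Q.map (fun x => ∑ t ∈ s, c t * x t) = gaussianReal 0 (‖∑ t ∈ s, c t • h t‖ ^ 2).toNNReal)
    (t u : T) : cov[fun x : T → ℝ => x t, fun x => x u; Q] = inner ℝ (h t) (h u) := by
  classical
  have hv (t : T) : Var[fun x : T → ℝ => x t; Q] = ‖h t‖ ^ 2 := by
    rw [(hasLaw_eval_of_map_sum hQ t).variance_eq, variance_id_gaussianReal,
      Real.coe_toNNReal _ (by positivity)]
  have hm (t : T) : MemLp (fun x : T → ℝ => x t) 2 Q :=
    (hasLaw_eval_of_map_sum hQ t).hasGaussianLaw.memLp_two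
  obtain rfl | htu := eq_or_ne t u
  · rw [covariance_self (measurable_pi_apply t).aemeasurable, hv, real_inner_self_eq_norm_sq]
  · have hsum : HasLaw ((fun x : T → ℝ => x t) + fun x => x u)
        (gaussianReal 0 (‖h t + h u‖ ^ 2).toNNReal) Q :=
      ⟨by fun_prop, by simpa [Finset.sum_pair htu, Pi.add_def] using hQ {t, u} 1⟩
    have h1 := hsum.variance_eq
    rw [variance_add (hm t) (hm u), hv, hv, variance_id_gaussianReal,
      Real.coe_toNNReal _ (by positivity), norm_add_sq_real] at h1
    linarith

end

/-! ### Weak convergence of processes from finite-dimensional distributions -/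

/-- A continuous function on a product of copies of a compact Hausdorff space depends, up to a
uniformly small error, on finitely many coordinates only. -/
lemma exists_finset_forall_abs_sub_lt {T X : Type*} [TopologicalSpace X] [CompactSpace X]
    [T2Space X] {F : (T → X) → ℝ} (hF : Continuous F) {ε : ℝ} (hε : 0 < ε) :
    ∃ S : Finset T, ∀ x y : T → X, (∀ t ∈ S, x t = y t) → |F x - F y| < ε := by
  let _ : UniformSpace X := uniformSpaceOfCompactR1
  have hu : UniformContinuous F := CompactSpace.uniformContinuous_of_continuous hF
  have hmem := hu (Metric.dist_mem_uniformity hε)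
  rw [Filter.mem_map, Pi.uniformity, Filter.mem_iInf] at hmem
  obtain ⟨I, hI, V, hV, hVeq⟩ := hmem
  refine ⟨hI.toFinset, fun x y hxy => ?_⟩
  have : (x, y) ∈ ⋂ i, V i := by
    refine Set.mem_iInter.2 fun i => ?_
    obtain ⟨W, hW, hWV⟩ := hV i
    refine hWV ?_
    have := hxy i (by simp)
    simpa [this] using refl_mem_uniformity hW
  rw [← hVeq] at this
  exact this

open Classical in
/-- The path that agrees with `y` on the finite set `S` of indices and vanishes elsewhere. -/
noncomputable def extendZero {T : Type*} (S : Finset T) (y : S → EReal) (t : T) : EReal :=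
  if ht : t ∈ S then y ⟨t, ht⟩ else 0

lemma extendZero_of_mem {T : Type*} {S : Finset T} {t : T} (ht : t ∈ S) (y : S → EReal) :
    extendZero S y t = y ⟨t, ht⟩ := dif_pos ht

lemma continuous_extendZero {T : Type*} (S : Finset T) : Continuous (extendZero S) := by
  refine continuous_pi fun t => ?_
  by_cases ht : t ∈ S
  · simpa only [extendZero_of_mem ht] using continuous_apply _
  · simpa only [extendZero, dif_neg ht] using continuous_const

section

variable {T Ω Ω' : Type*} [MeasurableSpace Ω] [MeasurableSpace Ω']
  {P : Measure Ω} {Q : Measure Ω'}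

/-- A continuous functional of a path is measurable even if the index set is uncountable: it is
a limit of functionals of finitely many coordinates. -/
lemma aemeasurable_continuous_comp_path {A : T → Ω → EReal} (hA : ∀ t, AEMeasurable (A t) P)
    {F : (T → EReal) → ℝ} (hF : Continuous F) : AEMeasurable (fun ω => F fun t => A t ω) P := by
  choose S hS using fun k : ℕ => exists_finset_forall_abs_sub_lt hF
    (Nat.one_div_pos_of_nat (α := ℝ) (n := k))
  refine aemeasurable_of_tendsto_metrizable_ae atTop
    (f := fun k ω => F (extendZero (S k) fun t => A t ω)) (fun k => ?_) (.of_forall fun ω => ?_)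
  · exact (hF.comp (continuous_extendZero (S k))).measurable.comp_aemeasurable
      (aemeasurable_pi_lambda _ fun t => hA t)
  · refine tendsto_iff_dist_tendsto_zero.2 (squeeze_zero (fun _ => dist_nonneg)
      (fun k => ?_) tendsto_one_div_add_atTop_nhds_zero_nat)
    exact (hS k _ _ fun t ht => extendZero_of_mem ht _).le

lemma integrable_continuous_comp_path [IsFiniteMeasure P] {A : T → Ω → EReal}
    (hA : ∀ t, AEMeasurable (A t) P) (F : BoundedContinuousFunction (T → EReal) ℝ) :
    Integrable (fun ω => F fun t => A t ω) P :=
  .of_bound (aemeasurable_continuous_comp_path hA F.continuous).aestronglyMeasurable ‖F‖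
    (.of_forall fun _ => F.norm_coe_le_norm _)

variable [IsProbabilityMeasure P]

/-- The functional `F` evaluated at the path that keeps the coordinates in `S` and is zero
elsewhere, as a function of real coordinates. -/
noncomputable def cylinderApprox (S : Finset T) (F : BoundedContinuousFunction (T → EReal) ℝ) :
    BoundedContinuousFunction (S → ℝ) ℝ :=
  F.compContinuous ⟨fun y => extendZero S fun t => (y t : EReal),
    (continuous_extendZero S).comp
      (continuous_pi fun t => continuous_coe_real_ereal.comp (continuous_apply t))⟩

lemma abs_integral_path_sub_le {Y : T → Ω → ℝ} (hY : ∀ t, AEMeasurable (Y t) P)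
    (F : BoundedContinuousFunction (T → EReal) ℝ) {S : Finset T} {ε : ℝ}
    (hS : ∀ x y : T → EReal, (∀ t ∈ S, x t = y t) → |F x - F y| < ε) :
    |∫ ω, F (fun t => (Y t ω : EReal)) ∂P - ∫ ω, cylinderApprox S F (fun t : S => Y t ω) ∂P|
      ≤ ε := by
  set g := cylinderApprox S F
  have hint : Integrable (fun ω => g (fun t : S => Y t ω)) P :=
    .of_bound (g.continuous.measurable.comp_aemeasurable
      (aemeasurable_pi_lambda (fun ω (t : S) => Y t ω) fun t => hY t)).aestronglyMeasurable ‖g‖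
      (.of_forall fun _ => g.norm_coe_le_norm _)
  rw [← integral_sub (integrable_continuous_comp_path (fun t => (hY t).coe_real_ereal) F) hint]
  have := norm_integral_le_of_norm_le_const (μ := P) (C := ε)
    (f := fun ω => F (fun t => (Y t ω : EReal)) - g (fun t : S => Y t ω))
    (.of_forall fun ω => (hS _ _ fun t ht =>
      (extendZero_of_mem ht fun t : S => (Y t ω : EReal)).symm).le)
  simpa using this

/-- Convergence in distribution of the finite-dimensional marginals of real processes gives
convergence of the expectations of all bounded continuous functionals of the path. -/
lemma tendsto_integral_path_of_tendstoInDistribution [IsProbabilityMeasure Q]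
    {B : ℕ → T → Ω → ℝ} {G : T → Ω' → ℝ}
    (hB : ∀ n t, AEMeasurable (B n t) P) (hG : ∀ t, AEMeasurable (G t) Q)
    (hBG : ∀ S : Finset T, TendstoInDistribution (fun n ω (t : S) => B n t ω) atTop
      (fun ω (t : S) => G t ω) (fun _ => P) Q)
    (F : BoundedContinuousFunction (T → EReal) ℝ) :
    Tendsto (fun n => ∫ ω, F (fun t => (B n t ω : EReal)) ∂P) atTop
      (𝓝 (∫ ω, F (fun t => (G t ω : EReal)) ∂Q)) := by
  rw [Metric.tendsto_atTop]
  intro ε hε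
  obtain ⟨S, hS⟩ := exists_finset_forall_abs_sub_lt F.continuous (ε := ε / 3) (by positivity)
  have h1 n := abs_integral_path_sub_le (hB n) F hS
  have h2 := abs_integral_path_sub_le hG F hS
  set g := cylinderApprox S F
  have hg := ProbabilityMeasure.tendsto_iff_forall_integral_tendsto.1 (hBG S).tendsto g
  simp only [ProbabilityMeasure.coe_mk] at hg
  rw [integral_map (aemeasurable_pi_lambda (fun ω (t : S) => G t ω) fun t => hG t)
    g.continuous.measurable.aestronglyMeasurable] at hg
  simp only [integral_map (aemeasurable_pi_lambda (fun ω (t : S) => B _ t ω) fun t => hB _ t)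
    g.continuous.measurable.aestronglyMeasurable] at hg
  obtain ⟨N, hN⟩ := Metric.tendsto_atTop.1 hg (ε / 3) (by positivity)
  refine ⟨N, fun n hn => ?_⟩
  replace h1 := h1 n
  have h3 := hN n hn
  rw [Real.dist_eq] at h3 ⊢
  rw [abs_le] at h1 h2
  rw [abs_lt] at h3 ⊢
  constructor <;> linarith [h1.1, h1.2, h2.1, h2.2, h3.1, h3.2]

/-- Extended-real processes `A n` converge weakly to a real process `G` as soon as, at each index,
they coincide with probability tending to one with real processes whose finite-dimensional
distributions converge to those of `G`. -/
theorem convergesWeakly_of_tendstoInDistribution [IsProbabilityMeasure Q]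
    {A : ℕ → T → Ω → EReal} {B : ℕ → T → Ω → ℝ}
    {G : T → Ω' → ℝ} (hA : ∀ n t, AEMeasurable (A n t) P) (hB : ∀ n t, AEMeasurable (B n t) P)
    (hG : ∀ t, AEMeasurable (G t) Q)
    (hBG : ∀ S : Finset T, TendstoInDistribution (fun n ω (t : S) => B n t ω) atTop
      (fun ω (t : S) => G t ω) (fun _ => P) Q)
    (hAB : ∀ t, Tendsto (fun n => P.real {ω | A n t ω ≠ B n t ω}) atTop (𝓝 0)) :
    ConvergesWeakly P A Q fun t ω => (G t ω : EReal) where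
  aemeasurable := hA
  aemeasurable_limit t := (hG t).coe_real_ereal
  integrable F n := integrable_continuous_comp_path (hA n) F
  integrable_limit F := integrable_continuous_comp_path (fun t => (hG t).coe_real_ereal) F
  tendsto F := by
    have hlim := tendsto_integral_path_of_tendstoInDistribution hB hG hBG F
    suffices h : Tendsto (fun n => ∫ ω, F (fun t => A n t ω) ∂P -
        ∫ ω, F (fun t => (B n t ω : EReal)) ∂P) atTop (𝓝 0) by
      simpa using h.add hlim
    rw [Metric.tendsto_atTop]
    intro ε hε
    obtain ⟨S, hS⟩ := exists_finset_forall_abs_sub_lt F.continuous (ε := ε / 2) (by positivity)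
    have hsum : Tendsto (fun n => ∑ t ∈ S, 2 * ‖F‖ * P.real {ω | A n t ω ≠ B n t ω}) atTop
        (𝓝 0) := by
      have := tendsto_finsetSum S fun t _ => (hAB t).const_mul (2 * ‖F‖)
      simpa using this
    obtain ⟨N, hN⟩ := Metric.tendsto_atTop.1 hsum (ε / 2) (by positivity)
    refine ⟨N, fun n hn => ?_⟩
    have hN' := hN n hn
    rw [dist_zero_right] at hN' ⊢
    have hnull (t : T) : NullMeasurableSet {ω | A n t ω ≠ B n t ω} P :=
      (nullMeasurableSet_eq_fun (hA n t) (hB n t).coe_real_ereal).compl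
    have hindi (t : T) : Integrable
        ({ω | A n t ω ≠ B n t ω}.indicator fun _ => 2 * ‖F‖) P :=
      (integrable_const _).indicator₀ (hnull t)
    rw [← integral_sub (integrable_continuous_comp_path (hA n) F)
      (integrable_continuous_comp_path (fun t => (hB n t).coe_real_ereal) F)]
    calc _ ≤ ∫ ω, (ε / 2 + ∑ t ∈ S, {ω | A n t ω ≠ B n t ω}.indicator (fun _ => 2 * ‖F‖) ω) ∂P := by
          refine norm_integral_le_of_norm_le
            ((integrable_const _).add (integrable_finsetSum _ fun t _ => hindi t))
            (.of_forall fun ω => ?_)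
          have hnn (t : T) : 0 ≤ {ω | A n t ω ≠ B n t ω}.indicator (fun _ => 2 * ‖F‖) ω :=
            Set.indicator_nonneg (fun _ _ => by positivity) _
          by_cases hω : ∀ t ∈ S, A n t ω = B n t ω
          · exact (hS _ _ hω).le.trans (le_add_of_nonneg_right (Finset.sum_nonneg fun t _ => hnn t))
          · push Not at hω
            obtain ⟨t, ht, hne⟩ := hω
            have h1 : {ω | A n t ω ≠ B n t ω}.indicator (fun _ => 2 * ‖F‖) ω = 2 * ‖F‖ :=
              Set.indicator_of_mem (s := {ω | A n t ω ≠ B n t ω}) hne _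
            have h2 := Finset.single_le_sum (fun t _ => hnn t) ht
            rw [h1] at h2
            have h3 := norm_sub_le (F fun t => A n t ω) (F fun t => (B n t ω : EReal))
            linarith [F.norm_coe_le_norm fun t => A n t ω,
              F.norm_coe_le_norm fun t => (B n t ω : EReal)]
      _ = ε / 2 + ∑ t ∈ S, 2 * ‖F‖ * P.real {ω | A n t ω ≠ B n t ω} := by
          rw [integral_add (integrable_const _) (integrable_finsetSum _ fun t _ => hindi t),
            integral_finsetSum _ fun t _ => hindi t]
          congr 1
          · simp
          · refine Finset.sum_congr rfl fun t _ => ?_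
            rw [integral_indicator₀ (hnull t), setIntegral_const, smul_eq_mul, mul_comm]
      _ < ε := by linarith [(abs_lt.1 hN').2]

end

/-! ### The multivariate central limit theorem -/

/-- The Cramér–Wold device: the characteristic function of a random vector is determined by the
laws of the linear combinations of its coordinates. -/
lemma charFun_map_toLp_eq_charFun_map_sum {Ω ι : Type*} [MeasurableSpace Ω] [Fintype ι]
    {μ : Measure Ω} {X : Ω → ι → ℝ} (hX : AEMeasurable X μ) (a : EuclideanSpace ℝ ι) :
    charFun (μ.map fun ω => WithLp.toLp 2 (X ω)) a =
      charFun (μ.map fun ω => ∑ i, a i * X ω i) 1 := by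
  have hX' (i : ι) : AEMeasurable (fun ω => X ω i) μ := hX.eval i
  rw [charFun_apply, charFun_apply, integral_map (by fun_prop) (by fun_prop),
    integral_map (by fun_prop) (by fun_prop)]
  simp [PiLp.inner_apply, mul_comm]

/-- Convergence in distribution of random vectors follows from convergence in distribution of all
linear combinations of the coordinates. -/
lemma tendstoInDistribution_pi_of_sum {Ω Ω' ι : Type*} [MeasurableSpace Ω] [MeasurableSpace Ω']
    [Fintype ι] {P : Measure Ω} [IsProbabilityMeasure P] {Q : Measure Ω'} [IsProbabilityMeasure Q]
    {X : ℕ → Ω → ι → ℝ} {Z : Ω' → ι → ℝ} (hX : ∀ n, AEMeasurable (X n) P)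
    (hZ : AEMeasurable Z Q)
    (h : ∀ a : ι → ℝ, TendstoInDistribution (fun n ω => ∑ i, a i * X n ω i) atTop
      (fun ω => ∑ i, a i * Z ω i) (fun _ => P) Q) :
    TendstoInDistribution X atTop Z (fun _ => P) Q := by
  have h2 : TendstoInDistribution (fun n ω => WithLp.toLp 2 (X n ω)) atTop
      (fun ω => WithLp.toLp 2 (Z ω)) (fun _ => P) Q := by
    refine ⟨fun n => by fun_prop, by fun_prop,
      ProbabilityMeasure.tendsto_iff_tendsto_charFun.2 fun a => ?_⟩
    simp only [ProbabilityMeasure.coe_mk, charFun_map_toLp_eq_charFun_map_sum hZ,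
      fun n => charFun_map_toLp_eq_charFun_map_sum (hX n)]
    exact ProbabilityMeasure.tendsto_iff_tendsto_charFun.1 (h a).tendsto 1
  exact h2.continuous_comp (g := fun x : EuclideanSpace ℝ ι => x.ofLp) (by fun_prop)

section

variable {Ω E T : Type*} [MeasurableSpace Ω] [MeasurableSpace E] {P : Measure Ω}
  [IsProbabilityMeasure P] {Y : ℕ → Ω → E}

/-- The central limit theorem for finitely many centred square integrable functions `f t` of an
iid sample. The limit is the Gaussian process whose covariances are the `L²` inner products of
the functions. -/
theorem tendstoInDistribution_inv_sqrt_mul_sum_pi (hY : ∀ k, Measurable (Y k))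
    (hind : iIndepFun Y P) (hid : ∀ k, IdentDistrib (Y k) (Y 0) P P) {f : T → E → ℝ}
    (hf : ∀ t, Measurable (f t)) (hL2 : ∀ t, MemLp (fun ω => f t (Y 0 ω)) 2 P)
    (hmean : ∀ t, ∫ ω, f t (Y 0 ω) ∂P = 0) {Q : Measure (T → ℝ)} [IsProbabilityMeasure Q]
    (hQ : ∀ (s : Finset T) (c : T → ℝ), Q.map (fun x => ∑ t ∈ s, c t * x t) =
      gaussianReal 0 (‖∑ t ∈ s, c t • (hL2 t).toLp‖ ^ 2).toNNReal) (S : Finset T) :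
    TendstoInDistribution
      (fun (n : ℕ) ω (t : S) => (√n)⁻¹ * ∑ k ∈ Finset.range n, f t (Y k ω)) atTop
      (fun x (t : S) => x t) (fun _ => P) Q := by
  classical
  refine tendstoInDistribution_pi_of_sum (fun n => by fun_prop)
    (measurable_pi_lambda _ fun t => measurable_pi_apply t.1).aemeasurable fun a => ?_
  let c (t : T) : ℝ := if ht : t ∈ S then a ⟨t, ht⟩ else 0
  have hc (y : T → ℝ) : ∑ t : S, a t * y t = ∑ t ∈ S, c t * y t := by
    rw [← Finset.sum_coe_sort S fun t => c t * y t]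
    exact Finset.sum_congr rfl fun t _ => by simp [c]
  -- the linear combination of the functions, which reduces the claim to the scalar theorem
  let g (y : E) : ℝ := ∑ t ∈ S, c t * f t y
  have hg : Measurable g := by fun_prop
  have hgL2 : MemLp (fun ω => g (Y 0 ω)) 2 P :=
    memLp_finsetSum S fun t _ => (hL2 t).const_mul (c t)
  have hg0 : ∫ ω, g (Y 0 ω) ∂P = 0 := by
    rw [integral_finsetSum _ fun t _ => ((hL2 t).integrable one_le_two).const_mul (c t)]
    simp [integral_const_mul, hmean]
  have hvar : Var[fun ω => g (Y 0 ω); P] = ‖∑ t ∈ S, c t • (hL2 t).toLp‖ ^ 2 := by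
    rw [variance_eq_integral (by fun_prop), hg0, ← real_inner_self_eq_norm_sq, L2.inner_def]
    refine integral_congr_ae ?_
    have h1 : ∀ᵐ ω ∂P, ∀ t ∈ S, (c t • (hL2 t).toLp : Lp ℝ 2 P) ω = c t * f t (Y 0 ω) := by
      rw [Finset.eventually_all]
      intro t _
      filter_upwards [Lp.coeFn_smul (c t) (hL2 t).toLp, (hL2 t).coeFn_toLp] with x h3 h4
      simp [h3, h4]
    filter_upwards [h1, Lp.coeFn_finsetSum S fun t => c t • (hL2 t).toLp] with ω h1 h2
    rw [h2, Finset.sum_apply, Finset.sum_congr rfl h1]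
    simp [g, sq]
  have hlaw : HasLaw (fun x : T → ℝ => ∑ t : S, a t * x t)
      (gaussianReal 0 Var[fun ω => g (Y 0 ω); P].toNNReal) Q := by
    have hm (t : S) : Measurable fun x : T → ℝ => a t * x t := (measurable_pi_apply t.1).const_mul _
    refine ⟨(Finset.measurable_fun_sum _ fun t _ => hm t).aemeasurable, ?_⟩
    simp only [hc]
    rw [hQ, hvar]
  have hclt := tendstoInDistribution_inv_sqrt_mul_sum_sub (X := fun k ω => g (Y k ω)) hlaw hgL2
    (hind.comp (fun _ => g) fun _ => hg) fun k => (hid k).comp hg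
  refine hclt.congr (fun n => .of_forall fun ω => ?_) .rfl
  simp only [hg0, hc (fun t => (√n)⁻¹ * ∑ k ∈ Finset.range n, f t (Y k ω)), g, mul_zero, sub_zero]
  rw [Finset.sum_comm, Finset.mul_sum]
  refine Finset.sum_congr rfl fun t _ => ?_
  rw [← Finset.mul_sum]
  ring

end

/-! ### Logarithms of empirical frequencies -/

/-- The relative frequency of the set `A` among the first `n` terms of the sequence `Y`. -/
noncomputable def empFreq {Ω E : Type*} (Y : ℕ → Ω → E) (A : Set E) (n : ℕ) (ω : Ω) : ℝ :=
  (1 / (n : ℝ)) * ∑ k ∈ Finset.range n, A.indicator 1 (Y k ω)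

section

variable {Ω E : Type*} [MeasurableSpace Ω] [MeasurableSpace E] {P : Measure Ω}
  [IsProbabilityMeasure P] {Y : ℕ → Ω → E}

lemma measurable_empFreq (hY : ∀ k, Measurable (Y k)) {A : Set E} (hA : MeasurableSet A) (n : ℕ) :
    Measurable (empFreq Y A n) := by
  have h : Measurable (A.indicator (1 : E → ℝ)) := measurable_one.indicator hA
  exact (Finset.measurable_fun_sum _ fun k _ => h.comp (hY k)).const_mul _

/-- Chebyshev's inequality for relative frequencies. -/
lemma measureReal_le_abs_empFreq_sub_le (hY : ∀ k, Measurable (Y k)) (hind : iIndepFun Y P)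
    (hid : ∀ k, IdentDistrib (Y k) (Y 0) P P) {A : Set E} (hA : MeasurableSet A) {n : ℕ}
    (hn : 0 < n) {c : ℝ} (hc : 0 < c) :
    P.real {ω | c ≤ |empFreq Y A n ω - P.real (Y 0 ⁻¹' A)|} ≤ 1 / (n * c ^ 2) := by
  set g : E → ℝ := A.indicator 1
  have hg : Measurable g := measurable_one.indicator hA
  have hgb (y : E) : g y ∈ Set.Icc (0 : ℝ) 1 := by
    by_cases h : y ∈ A <;> simp [g, h]
  have hgL2 (k : ℕ) : MemLp (fun ω => g (Y k ω)) 2 P :=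
    .of_bound (hg.comp (hY k)).aestronglyMeasurable 1 (.of_forall fun ω => by
      rw [Real.norm_eq_abs, abs_le]; constructor <;> linarith [(hgb (Y k ω)).1, (hgb (Y k ω)).2])
  have hint (k : ℕ) : ∫ ω, g (Y k ω) ∂P = P.real (Y 0 ⁻¹' A) := by
    exact ((hid k).comp hg).integral_eq.trans (integral_indicator_one (hY 0 hA))
  have hn' : (n : ℝ) ≠ 0 := by positivity
  have hT : MemLp (empFreq Y A n) 2 P := (memLp_finsetSum _ fun k _ => hgL2 k).const_mul _
  have hmean : ∫ ω, empFreq Y A n ω ∂P = P.real (Y 0 ⁻¹' A) := by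
    simp only [empFreq]
    rw [integral_const_mul, integral_finsetSum _ fun k _ => (hgL2 k).integrable one_le_two,
      Finset.sum_congr rfl fun k _ => hint k]
    simp [hn']
  have hvar : Var[empFreq Y A n; P] ≤ 1 / n := by
    have h1 : Var[∑ k ∈ Finset.range n, fun ω => g (Y k ω); P] ≤ n := by
      rw [IndepFun.variance_sum (fun k _ => hgL2 k) fun i _ j _ hij =>
        (hind.indepFun hij).comp hg hg]
      calc _ ≤ ∑ k ∈ Finset.range n, (1 : ℝ) := Finset.sum_le_sum fun k _ =>
            (variance_le_sq_of_bounded (.of_forall fun ω => hgb (Y k ω)) (by fun_prop)).trans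
              (by norm_num)
        _ = n := by simp
    have h2 : empFreq Y A n = fun ω => (1 / (n : ℝ)) * (∑ k ∈ Finset.range n,
        fun ω => g (Y k ω)) ω := by
      ext ω
      simp [empFreq, g]
    rw [h2, variance_const_mul]
    calc _ ≤ (1 / (n : ℝ)) ^ 2 * n := by gcongr
      _ = 1 / n := by field_simp
  have hch := meas_ge_le_variance_div_sq hT hc
  rw [hmean] at hch
  refine (ENNReal.toReal_le_of_le_ofReal (div_nonneg (variance_nonneg _ _) (sq_nonneg _))
    hch).trans ?_
  rw [div_le_div_iff₀ (by positivity) (by positivity)]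
  have : Var[empFreq Y A n; P] * n ≤ 1 := by rwa [le_div_iff₀ (by positivity)] at hvar
  nlinarith [sq_nonneg c]

lemma abs_log_sub_log_sub_le {x p : ℝ} (hp : 0 < p) (h : |x - p| ≤ p / 2) :
    |Real.log x - Real.log p - (x / p - 1)| ≤ 2 * ((x - p) / p) ^ 2 := by
  have hx : 0 < x := by linarith [(abs_le.1 h).1]
  set y := 1 - x / p with hy
  have hyx : (x - p) / p = -y := by rw [hy]; field_simp; ring
  have hy2 : |y| ≤ 1 / 2 := by
    rw [← abs_neg, ← hyx, abs_div, abs_of_pos hp, div_le_iff₀ hp]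
    linarith
  have hlog := Real.abs_log_sub_add_sum_range_le (x := y) (by linarith) 1
  have h1 : Real.log (1 - y) = Real.log x - Real.log p := by
    rw [hy, sub_sub_cancel, Real.log_div hx.ne' hp.ne']
  simp only [Finset.sum_range_one, h1] at hlog
  rw [hyx, show Real.log x - Real.log p - (x / p - 1) =
    y ^ (0 + 1) / ((0 : ℕ) + 1 : ℝ) + (Real.log x - Real.log p) by rw [hy]; push_cast; ring]
  refine hlog.trans ?_
  rw [div_le_iff₀ (by linarith), sq_abs, neg_sq]
  nlinarith [sq_nonneg y]

lemma tendsto_measureReal_le_abs_empFreq_sub (hY : ∀ k, Measurable (Y k)) (hind : iIndepFun Y P)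
    (hid : ∀ k, IdentDistrib (Y k) (Y 0) P P) {A : Set E} (hA : MeasurableSet A)
    {c : ℝ} (hc : 0 < c) :
    Tendsto (fun n => P.real {ω | c ≤ |empFreq Y A n ω - P.real (Y 0 ⁻¹' A)|}) atTop (𝓝 0) := by
  have hlim : Tendsto (fun n : ℕ => (1 / c ^ 2) * (1 / (n : ℝ))) atTop (𝓝 0) := by
    rw [← mul_zero (1 / c ^ 2)]
    exact tendsto_one_div_atTop_nhds_zero_nat.const_mul _
  refine squeeze_zero' (.of_forall fun n => measureReal_nonneg) ?_ hlim
  filter_upwards [eventually_gt_atTop 0] with n hn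
  refine (measureReal_le_abs_empFreq_sub_le hY hind hid hA hn hc).trans (le_of_eq ?_)
  field_simp

/-- The delta method for the logarithm of a relative frequency: the error of the linearization,
multiplied by `√n`, tends to zero in probability, because it is of the order of the squared
deviation, whose expectation is of the order `1 / n`. -/
lemma tendsto_measureReal_log_empFreq_remainder (hY : ∀ k, Measurable (Y k))
    (hind : iIndepFun Y P) (hid : ∀ k, IdentDistrib (Y k) (Y 0) P P) {A : Set E}
    (hA : MeasurableSet A) {p : ℝ} (hp : P.real (Y 0 ⁻¹' A) = p) (hp0 : 0 < p) {ε : ℝ}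
    (hε : 0 < ε) :
    Tendsto (fun n : ℕ => P.real {ω | ε ≤ |√n * (Real.log (empFreq Y A n ω) - Real.log p) -
      √n * (empFreq Y A n ω / p - 1)|}) atTop (𝓝 0) := by
  have hlim : Tendsto (fun n : ℕ => P.real {ω | p / 2 ≤ |empFreq Y A n ω - p|} +
      2 / (ε * p ^ 2) * (√n)⁻¹) atTop (𝓝 0) := by
    have h1 := tendsto_measureReal_le_abs_empFreq_sub hY hind hid hA (half_pos hp0)
    rw [hp] at h1
    have h2 : Tendsto (fun n : ℕ => (√n)⁻¹) atTop (𝓝 0) := tendsto_inv_atTop_zero.comp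
      (Real.tendsto_sqrt_atTop.comp tendsto_natCast_atTop_atTop)
    simpa using h1.add (h2.const_mul (2 / (ε * p ^ 2)))
  refine squeeze_zero' (.of_forall fun n => measureReal_nonneg) ?_ hlim
  filter_upwards [eventually_gt_atTop 0] with n hn
  have hs : 0 < √(n : ℝ) := by positivity
  have hs2 : √(n : ℝ) ^ 2 = n := Real.sq_sqrt (by positivity)
  -- the deviation at which the quadratic bound on the error reaches `ε`
  set c : ℝ := p * √(ε / (2 * √n)) with hc
  have hc0 : 0 < c := by positivity
  have hc2 : c ^ 2 = p ^ 2 * (ε / (2 * √n)) := by rw [hc, mul_pow, Real.sq_sqrt (by positivity)]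
  have hsub : {ω | ε ≤ |√n * (Real.log (empFreq Y A n ω) - Real.log p) -
      √n * (empFreq Y A n ω / p - 1)|} ⊆
      {ω | p / 2 ≤ |empFreq Y A n ω - p|} ∪ {ω | c ≤ |empFreq Y A n ω - p|} := by
    intro ω hω
    simp only [Set.mem_union, Set.mem_ofPred_eq] at hω ⊢
    by_contra! hcon
    have h1 := abs_log_sub_log_sub_le hp0 hcon.1.le
    rw [← mul_sub, abs_mul, abs_of_pos hs] at hω
    have h2 : (empFreq Y A n ω - p) ^ 2 < c ^ 2 := by
      rw [← sq_abs]
      exact pow_lt_pow_left₀ hcon.2 (abs_nonneg _) two_ne_zero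
    have h3 : 2 * ((empFreq Y A n ω - p) / p) ^ 2 < ε / √n := by
      rw [div_pow, ← mul_div_assoc, div_lt_div_iff₀ (by positivity) hs]
      rw [hc2] at h2
      have : 2 * (p ^ 2 * (ε / (2 * √n))) * √n = ε * p ^ 2 := by field_simp
      rw [← this]
      gcongr
    have h4 := h1.trans_lt h3
    rw [lt_div_iff₀ hs] at h4
    linarith
  refine (measureReal_mono hsub).trans ((measureReal_union_le _ _).trans ?_)
  gcongr
  have h5 := measureReal_le_abs_empFreq_sub_le hY hind hid hA hn hc0
  rw [hp, hc2] at h5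
  refine h5.trans (le_of_eq ?_)
  rw [div_mul_eq_mul_div, div_eq_div_iff (by positivity) (by positivity), ← hs2,
    Real.sqrt_sq hs.le]
  field_simp

end

/-! ### Random vectors with a copula as distribution function -/

section

variable {Ω : Type*} [MeasurableSpace Ω] {P : Measure Ω} [IsProbabilityMeasure P]
  {C : ℝ → ℝ → ℝ} {X : Ω → ℝ × ℝ}

lemma IsCopula.ae_le_one (hC : IsCopula C) (hX : Measurable X)
    (hlaw : ∀ a ∈ Set.Icc (0 : ℝ) 1, ∀ b ∈ Set.Icc (0 : ℝ) 1,
      P.real {ω | (X ω).1 ≤ a ∧ (X ω).2 ≤ b} = C a b) :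
    ∀ᵐ ω ∂P, (X ω).1 ≤ 1 ∧ (X ω).2 ≤ 1 := by
  have h1 : (1 : ℝ) ∈ Set.Icc (0 : ℝ) 1 := by simp
  have h := hlaw 1 h1 1 h1
  rw [hC.one_left 1 h1, measureReal_def, ENNReal.toReal_eq_one_iff] at h
  exact (mem_ae_iff_prob_eq_one
    ((hX.fst measurableSet_Iic).inter (hX.snd measurableSet_Iic))).2 h

lemma IsCopula.measureReal_fst_le (hC : IsCopula C) (hX : Measurable X)
    (hlaw : ∀ a ∈ Set.Icc (0 : ℝ) 1, ∀ b ∈ Set.Icc (0 : ℝ) 1,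
      P.real {ω | (X ω).1 ≤ a ∧ (X ω).2 ≤ b} = C a b) {a : ℝ} (ha : a ∈ Set.Icc (0 : ℝ) 1) :
    P.real {ω | (X ω).1 ≤ a} = a := by
  refine Eq.trans ?_ ((hlaw a ha 1 (by simp)).trans (hC.one_right a ha))
  refine measureReal_congr ?_
  filter_upwards [hC.ae_le_one hX hlaw] with ω hω
  exact propext ⟨fun h => ⟨h, hω.2⟩, fun h => h.1⟩

lemma IsCopula.measureReal_snd_le (hC : IsCopula C) (hX : Measurable X)
    (hlaw : ∀ a ∈ Set.Icc (0 : ℝ) 1, ∀ b ∈ Set.Icc (0 : ℝ) 1,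
      P.real {ω | (X ω).1 ≤ a ∧ (X ω).2 ≤ b} = C a b) {b : ℝ} (hb : b ∈ Set.Icc (0 : ℝ) 1) :
    P.real {ω | (X ω).2 ≤ b} = b := by
  refine Eq.trans ?_ ((hlaw 1 (by simp) b hb).trans (hC.one_left b hb))
  refine measureReal_congr ?_
  filter_upwards [hC.ae_le_one hX hlaw] with ω hω
  exact propext ⟨fun h => ⟨hω.1, h⟩, fun h => h.2⟩

/-- The distribution function of a uniform variable does not move a point across a level in
`[0, 1)`. -/
lemma cdf_map_le_iff_of_uniform {Z : Ω → ℝ} (hZ : Measurable Z)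
    (hunif : ∀ a ∈ Set.Icc (0 : ℝ) 1, P.real {ω | Z ω ≤ a} = a) {u : ℝ}
    (hu : u ∈ Set.Ico (0 : ℝ) 1) (x : ℝ) : cdf (P.map Z) x ≤ u ↔ x ≤ u := by
  have := Measure.isProbabilityMeasure_map (μ := P) hZ.aemeasurable
  have hcdf (a : ℝ) (ha : a ∈ Set.Icc (0 : ℝ) 1) : cdf (P.map Z) a = a := by
    rw [cdf_eq_real, map_measureReal_apply hZ measurableSet_Iic]
    exact hunif a ha
  constructor
  · intro h
    by_contra! hx
    have h1 : min x 1 ∈ Set.Icc (0 : ℝ) 1 :=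
      ⟨le_min (hu.1.trans hx.le) zero_le_one, min_le_right _ _⟩
    have h2 := monotone_cdf (P.map Z) (min_le_left x 1)
    rw [hcdf _ h1] at h2
    exact absurd (h2.trans h) (not_le.2 (lt_min hx hu.2))
  · intro h
    exact (monotone_cdf (P.map Z) h).trans (hcdf u ⟨hu.1, hu.2.le⟩).le

/-- A uniform variable has no atoms. -/
lemma measureReal_eq_zero_of_uniform {Z : Ω → ℝ} (hZ : Measurable Z)
    (hunif : ∀ a ∈ Set.Icc (0 : ℝ) 1, P.real {ω | Z ω ≤ a} = a) {a : ℝ}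
    (ha : a ∈ Set.Ioc (0 : ℝ) 1) : P.real {ω | Z ω = a} = 0 := by
  refine le_antisymm (le_of_forall_pos_le_add fun ε hε => ?_) measureReal_nonneg
  set b := max 0 (a - ε)
  have hb : b < a := max_lt ha.1 (by linarith)
  have hb' : b ∈ Set.Icc (0 : ℝ) 1 := ⟨le_max_left _ _, hb.le.trans ha.2⟩
  have hsub : {ω | Z ω ≤ b} ⊆ {ω | Z ω ≤ a} := fun ω (h : Z ω ≤ b) => h.trans hb.le
  calc P.real {ω | Z ω = a} ≤ P.real ({ω | Z ω ≤ a} \ {ω | Z ω ≤ b}) :=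
        measureReal_mono fun ω (h : Z ω = a) => ⟨h.le, not_le.2 (h ▸ hb)⟩
    _ = a - b := by
        rw [measureReal_sdiff hsub (hZ measurableSet_Iic), hunif a ⟨ha.1.le, ha.2⟩, hunif b hb']
    _ ≤ 0 + ε := by linarith [le_max_right 0 (a - ε)]

lemma IsCopula.measureReal_survival (hC : IsCopula C) (hX : Measurable X)
    (hlaw : ∀ a ∈ Set.Icc (0 : ℝ) 1, ∀ b ∈ Set.Icc (0 : ℝ) 1,
      P.real {ω | (X ω).1 ≤ a ∧ (X ω).2 ≤ b} = C a b) {a b : ℝ} (ha : a ∈ Set.Icc (0 : ℝ) 1)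
    (hb : b ∈ Set.Icc (0 : ℝ) 1) :
    P.real {ω | a < (X ω).1 ∧ b < (X ω).2} = survival C a b := by
  have hm1 : MeasurableSet {ω | (X ω).1 ≤ a} := hX.fst measurableSet_Iic
  have hm2 : MeasurableSet {ω | (X ω).2 ≤ b} := hX.snd measurableSet_Iic
  have h1 : {ω | a < (X ω).1 ∧ b < (X ω).2} = ({ω | (X ω).1 ≤ a} ∪ {ω | (X ω).2 ≤ b})ᶜ := by
    ext ω
    simp
  have h2 := measureReal_union_add_inter (μ := P) (s := {ω | (X ω).1 ≤ a}) hm2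
  have h3 : P.real ({ω | (X ω).1 ≤ a} ∩ {ω | (X ω).2 ≤ b}) = C a b := hlaw a ha b hb
  rw [hC.measureReal_fst_le hX hlaw ha, hC.measureReal_snd_le hX hlaw hb, h3] at h2
  rw [h1, probReal_compl_eq_one_sub (hm1.union hm2), survival]
  linarith

/-- For a vector with uniform margins, `α(u)` is the logarithmic ratio of the survival function
and of the copula on the diagonal. -/
lemma IsCopula.tailAlpha_eq (hC : IsCopula C) (hX : Measurable X)
    (hlaw : ∀ a ∈ Set.Icc (0 : ℝ) 1, ∀ b ∈ Set.Icc (0 : ℝ) 1,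
      P.real {ω | (X ω).1 ≤ a ∧ (X ω).2 ≤ b} = C a b) {u : ℝ} (hu : 0 < u) (hu1 : u < 1) :
    tailAlpha P X u = logRatio (survival C (1 - u) (1 - u)) (C u u) := by
  have h1 {v : ℝ} := cdf_map_le_iff_of_uniform (u := v) hX.fst
    fun a ha => hC.measureReal_fst_le hX hlaw ha
  have h2 {v : ℝ} := cdf_map_le_iff_of_uniform (u := v) hX.snd
    fun a ha => hC.measureReal_snd_le hX hlaw ha
  have hu' : 1 - u ∈ Set.Ico (0 : ℝ) 1 := ⟨by linarith, by linarith⟩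
  have hu'' : u ∈ Set.Ico (0 : ℝ) 1 := ⟨hu.le, hu1⟩
  rw [tailAlpha, ← hC.measureReal_survival hX hlaw ⟨hu'.1, hu'.2.le⟩ ⟨hu'.1, hu'.2.le⟩,
    ← hlaw u ⟨hu.le, hu1.le⟩ u ⟨hu.le, hu1.le⟩]
  simp only [← not_le, h1 hu', h2 hu', h1 hu'', h2 hu'']

/-- The lower corner `(-∞, u]²` of the plane. -/
def lowerCorner (u : ℝ) : Set (ℝ × ℝ) := {x | x.1 ≤ u ∧ x.2 ≤ u}

/-- The upper corner `[1 - u, ∞)²` of the plane. -/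
def upperCorner (u : ℝ) : Set (ℝ × ℝ) := {x | 1 - u ≤ x.1 ∧ 1 - u ≤ x.2}

lemma measurableSet_lowerCorner (u : ℝ) : MeasurableSet (lowerCorner u) :=
  (measurable_fst measurableSet_Iic).inter (measurable_snd measurableSet_Iic)

lemma measurableSet_upperCorner (u : ℝ) : MeasurableSet (upperCorner u) :=
  (measurable_fst measurableSet_Ici).inter (measurable_snd measurableSet_Ici)

lemma lowerCorner_inter (u v : ℝ) :
    lowerCorner u ∩ lowerCorner v = lowerCorner (min u v) := by
  ext x
  simp only [lowerCorner, Set.mem_inter_iff, Set.mem_ofPred_eq, le_min_iff]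
  tauto

lemma upperCorner_inter (u v : ℝ) :
    upperCorner u ∩ upperCorner v = upperCorner (min u v) := by
  ext x
  simp only [upperCorner, Set.mem_inter_iff, Set.mem_ofPred_eq]
  rcases le_total u v with h | h
  · rw [min_eq_left h]
    exact ⟨fun h => h.1, fun h => ⟨h, by linarith, by linarith⟩⟩
  · rw [min_eq_right h]
    exact ⟨fun h => h.2, fun h => ⟨⟨by linarith, by linarith⟩, h⟩⟩

lemma IsCopula.measureReal_upperCorner (hC : IsCopula C) (hX : Measurable X)
    (hlaw : ∀ a ∈ Set.Icc (0 : ℝ) 1, ∀ b ∈ Set.Icc (0 : ℝ) 1,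
      P.real {ω | (X ω).1 ≤ a ∧ (X ω).2 ≤ b} = C a b) {u : ℝ} (hu : 0 < u) (hu1 : u < 1) :
    P.real (X ⁻¹' upperCorner u) = survival C (1 - u) (1 - u) := by
  have hI : 1 - u ∈ Set.Icc (0 : ℝ) 1 := ⟨by linarith, by linarith⟩
  rw [← hC.measureReal_survival hX hlaw hI hI]
  have h1 := measureReal_eq_zero_of_uniform hX.fst
    (fun a ha => hC.measureReal_fst_le hX hlaw ha) (a := 1 - u) ⟨by linarith, by linarith⟩
  have h2 := measureReal_eq_zero_of_uniform hX.snd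
    (fun a ha => hC.measureReal_snd_le hX hlaw ha) (a := 1 - u) ⟨by linarith, by linarith⟩
  rw [measureReal_eq_zero_iff, measure_eq_zero_iff_ae_notMem] at h1 h2
  refine measureReal_congr ?_
  filter_upwards [h1, h2] with ω h1 h2
  exact propext ⟨fun h => ⟨lt_of_le_of_ne h.1 (Ne.symm h1), lt_of_le_of_ne h.2 (Ne.symm h2)⟩,
    fun h => ⟨h.1.le, h.2.le⟩⟩

/-- For levels up to `1/2`, the corners at opposite ends meet in a null set: they can only touch,
on a line on which a vector with uniform margins has no mass. -/
lemma IsCopula.ae_notMem_upperCorner_inter_lowerCorner (hC : IsCopula C) (hX : Measurable X)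
    (hlaw : ∀ a ∈ Set.Icc (0 : ℝ) 1, ∀ b ∈ Set.Icc (0 : ℝ) 1,
      P.real {ω | (X ω).1 ≤ a ∧ (X ω).2 ≤ b} = C a b) {u v : ℝ} (hu : u ≤ 1 / 2)
    (hv : v ≤ 1 / 2) : ∀ᵐ ω ∂P, ¬ (X ω ∈ upperCorner u ∧ X ω ∈ lowerCorner v) := by
  have h1 := measureReal_eq_zero_of_uniform hX.fst
    (fun a ha => hC.measureReal_fst_le hX hlaw ha) (a := 1 / 2) (by norm_num)
  rw [measureReal_eq_zero_iff, measure_eq_zero_iff_ae_notMem] at h1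
  filter_upwards [h1] with ω h1 h
  exact h1 (le_antisymm (h.2.1.trans hv) (by linarith [h.1.1]))

/-- The values of the joint distribution function on the unit square determine it everywhere. -/
lemma IsCopula.measureReal_le_le (hC : IsCopula C) (hX : Measurable X)
    (hlaw : ∀ a ∈ Set.Icc (0 : ℝ) 1, ∀ b ∈ Set.Icc (0 : ℝ) 1,
      P.real {ω | (X ω).1 ≤ a ∧ (X ω).2 ≤ b} = C a b) (a b : ℝ) :
    P.real {ω | (X ω).1 ≤ a ∧ (X ω).2 ≤ b} = C (max 0 (min a 1)) (max 0 (min b 1)) := by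
  have hcl (c : ℝ) : max 0 (min c 1) ∈ Set.Icc (0 : ℝ) 1 := by simp
  rw [← hlaw _ (hcl a) _ (hcl b)]
  have h1 := hC.measureReal_fst_le hX hlaw (a := 0) (by simp)
  have h2 := hC.measureReal_snd_le hX hlaw (b := 0) (by simp)
  rw [measureReal_eq_zero_iff, measure_eq_zero_iff_ae_notMem] at h1 h2
  refine measureReal_congr ?_
  filter_upwards [h1, h2, hC.ae_le_one hX hlaw] with ω h1 h2 h3
  have key {x c : ℝ} (hx0 : 0 < x) (hx1 : x ≤ 1) : x ≤ c ↔ x ≤ max 0 (min c 1) := by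
    rw [le_max_iff, le_min_iff]
    exact ⟨fun h => .inr ⟨h, hx1⟩, fun h => h.elim (fun h => absurd h (not_le.2 hx0)) And.left⟩
  exact propext (and_congr (key (not_le.1 h1) h3.1) (key (not_le.1 h2) h3.2))

/-- The joint distribution function determines the law. -/
lemma measure_prod_ext_of_Iic {μ ν : Measure (ℝ × ℝ)} [IsProbabilityMeasure μ]
    [IsProbabilityMeasure ν]
    (h : ∀ a b : ℝ, μ (Set.Iic a ×ˢ Set.Iic b) = ν (Set.Iic a ×ˢ Set.Iic b)) : μ = ν := by
  have hspan : IsCountablySpanning (Set.range (Set.Iic : ℝ → Set ℝ)) :=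
    ⟨fun n : ℕ => Set.Iic (n : ℝ), fun n => ⟨n, rfl⟩, Set.iUnion_eq_univ_iff.2 exists_nat_ge⟩
  have hgen : MeasurableSpace.generateFrom (Set.range (Set.Iic : ℝ → Set ℝ)) =
      (inferInstance : MeasurableSpace ℝ) :=
    (borel_eq_generateFrom_Iic ℝ).symm.trans (BorelSpace.measurable_eq (α := ℝ)).symm
  refine ext_of_generate_finite _ (generateFrom_eq_prod hgen hgen hspan hspan).symm
    (isPiSystem_Iic.prod isPiSystem_Iic) ?_ (by simp)
  rintro _ ⟨_, ⟨a, rfl⟩, _, ⟨b, rfl⟩, rfl⟩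
  exact h a b

lemma IsIIDSample.identDistrib {U : ℕ → Ω → ℝ × ℝ} (hU : IsIIDSample P C U) (hC : IsCopula C)
    (k : ℕ) : IdentDistrib (U k) (U 0) P P := by
  refine ⟨(hU.measurable k).aemeasurable, (hU.measurable 0).aemeasurable, ?_⟩
  have hp (i : ℕ) := Measure.isProbabilityMeasure_map (μ := P) (hU.measurable i).aemeasurable
  have hp0 := hp 0
  have hpk := hp k
  have hval (i : ℕ) (a b : ℝ) : (P.map (U i)).real (Set.Iic a ×ˢ Set.Iic b) =
      C (max 0 (min a 1)) (max 0 (min b 1)) := by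
    rw [map_measureReal_apply (hU.measurable i) (measurableSet_Iic.prod measurableSet_Iic)]
    exact hC.measureReal_le_le (hU.measurable i) (hU.law i) a b
  refine measure_prod_ext_of_Iic fun a b => ?_
  rw [← measureReal_eq_measureReal_iff, hval, hval]

end

/-! ### The tail asymmetry process -/

/-- The influence function of `α(u)`, that is, the derivative of the logarithmic ratio of the tail
probabilities in the direction of a point mass at `x`. -/
noncomputable def influence (C : ℝ → ℝ → ℝ) (u : ℝ) (x : ℝ × ℝ) : ℝ :=
  (upperCorner u).indicator 1 x / survival C (1 - u) (1 - u) - (lowerCorner u).indicator 1 x / C u u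

lemma measurable_influence (C : ℝ → ℝ → ℝ) (u : ℝ) : Measurable (influence C u) :=
  ((measurable_one.indicator (measurableSet_upperCorner u)).div_const _).sub
    ((measurable_one.indicator (measurableSet_lowerCorner u)).div_const _)

lemma lowerFreq_eq_empFreq {Ω : Type*} (U : ℕ → Ω → ℝ × ℝ) (n : ℕ) (u : ℝ) :
    lowerFreq U n u = empFreq U (lowerCorner u) n := by
  ext ω
  refine congrArg _ (Finset.sum_congr rfl fun k _ => ?_)
  by_cases h : U k ω ∈ lowerCorner u
  · exact (if_pos h).trans (Set.indicator_of_mem h 1).symm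
  · exact (if_neg h).trans (Set.indicator_of_notMem h 1).symm

lemma upperFreq_eq_empFreq {Ω : Type*} (U : ℕ → Ω → ℝ × ℝ) (n : ℕ) (u : ℝ) :
    upperFreq U n u = empFreq U (upperCorner u) n := by
  ext ω
  refine congrArg _ (Finset.sum_congr rfl fun k _ => ?_)
  by_cases h : U k ω ∈ upperCorner u
  · exact (if_pos h).trans (Set.indicator_of_mem h 1).symm
  · exact (if_neg h).trans (Set.indicator_of_notMem h 1).symm

lemma logRatio_of_pos {x y : ℝ} (hx : 0 < x) (hy : 0 < y) :
    logRatio x y = ((Real.log x - Real.log y : ℝ) : EReal) := by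
  simp [logRatio, hx.ne', hy.ne', Real.log_div]

lemma measurable_logRatio : Measurable fun x : ℝ × ℝ => logRatio x.1 x.2 := by
  unfold logRatio
  have h1 : MeasurableSet {x : ℝ × ℝ | x.1 = 0} := measurable_fst (measurableSet_singleton 0)
  have h2 : MeasurableSet {x : ℝ × ℝ | x.2 = 0} := measurable_snd (measurableSet_singleton 0)
  refine .ite (h1.inter h2) measurable_const
    (.ite h2 measurable_const (.ite h1 measurable_const ?_))
  exact (Real.measurable_log.comp (measurable_fst.div measurable_snd)).coe_real_ereal

section

variable {Ω : Type*} [MeasurableSpace Ω] {P : Measure Ω}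
  {C : ℝ → ℝ → ℝ} {X : Ω → ℝ × ℝ} {U : ℕ → Ω → ℝ × ℝ}

lemma integral_indicator_comp (hX : Measurable X) {A : Set (ℝ × ℝ)} (hA : MeasurableSet A) :
    ∫ ω, A.indicator (1 : ℝ × ℝ → ℝ) (X ω) ∂P = P.real (X ⁻¹' A) :=
  integral_indicator_one (hX hA)

/-- The process `𝔸ₙ` with the convention `log 0 = 0`, which makes it real-valued. -/
noncomputable def finiteAlpha (C : ℝ → ℝ → ℝ) (U : ℕ → Ω → ℝ × ℝ) (n : ℕ) (u : ℝ) (ω : Ω) : ℝ :=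
  √n * (Real.log (empFreq U (upperCorner u) n ω) - Real.log (empFreq U (lowerCorner u) n ω) -
    (Real.log (survival C (1 - u) (1 - u)) - Real.log (C u u)))

lemma measurable_finiteAlpha (hU : ∀ k, Measurable (U k)) (n : ℕ) (u : ℝ) :
    Measurable (finiteAlpha C U n u) :=
  ((((measurable_empFreq hU (measurableSet_upperCorner u) n).log).sub
    ((measurable_empFreq hU (measurableSet_lowerCorner u) n).log)).sub_const _).const_mul _

lemma measurable_alphaProcess (hU : ∀ k, Measurable (U k)) (n : ℕ) (u : ℝ) :
    Measurable (alphaProcess P U n u) := by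
  have h : Measurable (alphaHat U n u) := by
    unfold alphaHat
    rw [upperFreq_eq_empFreq, lowerFreq_eq_empFreq]
    exact measurable_logRatio.comp ((measurable_empFreq hU (measurableSet_upperCorner u) n).prodMk
      (measurable_empFreq hU (measurableSet_lowerCorner u) n))
  exact (h.sub_const _).const_mul _

variable [IsProbabilityMeasure P]

lemma memLp_influence (hX : Measurable X) (u : ℝ) :
    MemLp (fun ω => influence C u (X ω)) 2 P := by
  have h {A : Set (ℝ × ℝ)} (hA : MeasurableSet A) (c : ℝ) :
      MemLp (fun ω => A.indicator (1 : ℝ × ℝ → ℝ) (X ω) / c) 2 P := by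
    have h1 : MemLp (fun ω => A.indicator (1 : ℝ × ℝ → ℝ) (X ω)) 2 P :=
      .of_bound ((measurable_one.indicator hA).comp hX).aestronglyMeasurable 1
        (.of_forall fun ω => by by_cases hx : X ω ∈ A <;> simp [hx])
    simpa only [div_eq_mul_inv] using h1.mul_const c⁻¹
  exact (h (measurableSet_upperCorner u) _).sub (h (measurableSet_lowerCorner u) _)

lemma integrable_indicator_comp (hX : Measurable X) {A : Set (ℝ × ℝ)} (hA : MeasurableSet A) :
    Integrable (fun ω => A.indicator (1 : ℝ × ℝ → ℝ) (X ω)) P :=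
  (integrable_const (1 : ℝ)).indicator (hX hA)

lemma IsCopula.integral_influence (hC : IsCopula C) (hX : Measurable X)
    (hlaw : ∀ a ∈ Set.Icc (0 : ℝ) 1, ∀ b ∈ Set.Icc (0 : ℝ) 1,
      P.real {ω | (X ω).1 ≤ a ∧ (X ω).2 ≤ b} = C a b) {u : ℝ} (hu : u ∈ indexSet C) :
    ∫ ω, influence C u (X ω) ∂P = 0 := by
  obtain ⟨hu0, hu1, hL, hS⟩ := hu
  have hI : u ∈ Set.Icc (0 : ℝ) 1 := ⟨hu0.le, by linarith⟩
  have hlow : P.real (X ⁻¹' lowerCorner u) = C u u := hlaw u hI u hI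
  simp only [influence]
  rw [integral_sub ((integrable_indicator_comp hX (measurableSet_upperCorner u)).div_const _)
    ((integrable_indicator_comp hX (measurableSet_lowerCorner u)).div_const _), integral_div,
    integral_div, integral_indicator_comp hX (measurableSet_upperCorner u),
    integral_indicator_comp hX (measurableSet_lowerCorner u), hlow,
    hC.measureReal_upperCorner hX hlaw hu0 (by linarith), div_self hL.ne', div_self hS.ne',
    sub_self]

/-- The covariances of the influence functions. The mixed terms vanish because upper and lower
corners are almost surely disjoint, and the others collapse because the corners are nested. -/
lemma IsCopula.integral_influence_mul (hC : IsCopula C) (hX : Measurable X)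
    (hlaw : ∀ a ∈ Set.Icc (0 : ℝ) 1, ∀ b ∈ Set.Icc (0 : ℝ) 1,
      P.real {ω | (X ω).1 ≤ a ∧ (X ω).2 ≤ b} = C a b) {u v : ℝ} (hu : u ∈ indexSet C)
    (hv : v ∈ indexSet C) :
    ∫ ω, influence C u (X ω) * influence C v (X ω) ∂P = limitCov C u v := by
  obtain ⟨hu0, hu1, hLu, hSu⟩ := hu
  obtain ⟨hv0, hv1, hLv, hSv⟩ := hv
  have hw0 : 0 < min u v := lt_min hu0 hv0
  have hw1 : min u v < 1 := (min_le_left u v).trans_lt (by linarith)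
  have hlow : P.real (X ⁻¹' lowerCorner (min u v)) = C (min u v) (min u v) :=
    hlaw _ ⟨hw0.le, hw1.le⟩ _ ⟨hw0.le, hw1.le⟩
  have hae : (fun ω => influence C u (X ω) * influence C v (X ω)) =ᵐ[P] fun ω =>
      (upperCorner (min u v)).indicator (1 : ℝ × ℝ → ℝ) (X ω) /
        (survival C (1 - u) (1 - u) * survival C (1 - v) (1 - v)) +
      (lowerCorner (min u v)).indicator (1 : ℝ × ℝ → ℝ) (X ω) / (C u u * C v v) := by
    filter_upwards [hC.ae_notMem_upperCorner_inter_lowerCorner hX hlaw hu1 hv1,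
      hC.ae_notMem_upperCorner_inter_lowerCorner hX hlaw hv1 hu1] with ω h1 h2
    have h3 : (upperCorner u).indicator (1 : ℝ × ℝ → ℝ) (X ω) *
        (lowerCorner v).indicator (1 : ℝ × ℝ → ℝ) (X ω) = 0 := by
      by_cases h : X ω ∈ upperCorner u
      · rw [Set.indicator_of_notMem fun h' => h1 ⟨h, h'⟩, mul_zero]
      · rw [Set.indicator_of_notMem h, zero_mul]
    have h4 : (upperCorner v).indicator (1 : ℝ × ℝ → ℝ) (X ω) *
        (lowerCorner u).indicator (1 : ℝ × ℝ → ℝ) (X ω) = 0 := by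
      by_cases h : X ω ∈ upperCorner v
      · rw [Set.indicator_of_notMem fun h' => h2 ⟨h, h'⟩, mul_zero]
      · rw [Set.indicator_of_notMem h, zero_mul]
    rw [← upperCorner_inter, ← lowerCorner_inter, Set.inter_indicator_one,
      Set.inter_indicator_one]
    simp only [influence, Pi.mul_apply]
    field_simp
    linear_combination (-(survival C (1 - v) (1 - v) * C u u)) * h3 -
      (survival C (1 - u) (1 - u) * C v v) * h4
  rw [integral_congr_ae hae, integral_add
    ((integrable_indicator_comp hX (measurableSet_upperCorner _)).div_const _)
    ((integrable_indicator_comp hX (measurableSet_lowerCorner _)).div_const _), integral_div,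
    integral_div, integral_indicator_comp hX (measurableSet_upperCorner _),
    integral_indicator_comp hX (measurableSet_lowerCorner _), hlow,
    hC.measureReal_upperCorner hX hlaw hw0 hw1, limitCov]
  rcases le_total u v with h | h
  · rw [min_eq_left h, max_eq_right h, min_eq_right (by linarith)]
    field_simp
  · rw [min_eq_right h, max_eq_left h, min_eq_left (by linarith)]
    field_simp

lemma IsIIDSample.alphaProcess_eq (hU : IsIIDSample P C U) (hC : IsCopula C) {u : ℝ}
    (hu : u ∈ indexSet C) {n : ℕ} {ω : Ω} (hup : 0 < empFreq U (upperCorner u) n ω)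
    (hlow : 0 < empFreq U (lowerCorner u) n ω) :
    alphaProcess P U n u ω = finiteAlpha C U n u ω := by
  obtain ⟨hu0, hu1, hL, hS⟩ := hu
  rw [alphaProcess, alphaHat, upperFreq_eq_empFreq, lowerFreq_eq_empFreq, logRatio_of_pos hup hlow,
    hC.tailAlpha_eq (hU.measurable 0) (hU.law 0) hu0 (by linarith), logRatio_of_pos hS hL,
    ← EReal.coe_sub, ← EReal.coe_mul, finiteAlpha]

/-- The probability that an empirical tail frequency vanishes tends to zero, so the two versions
of the process agree with probability tending to one. -/
lemma IsIIDSample.tendsto_measureReal_alphaProcess_ne (hU : IsIIDSample P C U) (hC : IsCopula C)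
    {u : ℝ} (hu : u ∈ indexSet C) :
    Tendsto (fun n => P.real {ω | alphaProcess P U n u ω ≠ finiteAlpha C U n u ω}) atTop
      (𝓝 0) := by
  have ⟨hu0, hu1, hL, hS⟩ := hu
  have hI : u ∈ Set.Icc (0 : ℝ) 1 := ⟨hu0.le, by linarith⟩
  have hlow : P.real (U 0 ⁻¹' lowerCorner u) = C u u := hU.law 0 u hI u hI
  have hup := hC.measureReal_upperCorner (hU.measurable 0) (hU.law 0) hu0 (by linarith)
  have h1 := tendsto_measureReal_le_abs_empFreq_sub hU.measurable hU.indep (hU.identDistrib hC)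
    (measurableSet_upperCorner u) hS
  have h2 := tendsto_measureReal_le_abs_empFreq_sub hU.measurable hU.indep (hU.identDistrib hC)
    (measurableSet_lowerCorner u) hL
  rw [hup] at h1
  rw [hlow] at h2
  refine squeeze_zero (fun _ => measureReal_nonneg) (fun n => ?_) (by simpa using h1.add h2)
  refine (measureReal_mono fun ω hω => ?_).trans (measureReal_union_le _ _)
  by_contra hcon
  simp only [Set.mem_union, Set.mem_ofPred_eq, not_or, not_le, abs_lt] at hcon
  exact hω (hU.alphaProcess_eq hC hu (by linarith [hcon.1.1]) (by linarith [hcon.2.1]))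

/-- The linearization of the process by the sum of its influence functions. -/
lemma IsIIDSample.tendsto_measureReal_finiteAlpha_sub (hU : IsIIDSample P C U)
    (hC : IsCopula C) {u : ℝ} (hu : u ∈ indexSet C) {ε : ℝ} (hε : 0 < ε) :
    Tendsto (fun n : ℕ => P.real {ω | ε ≤ |finiteAlpha C U n u ω -
      (√n)⁻¹ * ∑ k ∈ Finset.range n, influence C u (U k ω)|}) atTop (𝓝 0) := by
  have ⟨hu0, hu1, hL, hS⟩ := hu
  have hI : u ∈ Set.Icc (0 : ℝ) 1 := ⟨hu0.le, by linarith⟩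
  have hlow : P.real (U 0 ⁻¹' lowerCorner u) = C u u := hU.law 0 u hI u hI
  have hup := hC.measureReal_upperCorner (hU.measurable 0) (hU.law 0) hu0 (by linarith)
  have h1 := tendsto_measureReal_log_empFreq_remainder hU.measurable hU.indep (hU.identDistrib hC)
    (measurableSet_upperCorner u) hup hS (half_pos hε)
  have h2 := tendsto_measureReal_log_empFreq_remainder hU.measurable hU.indep (hU.identDistrib hC)
    (measurableSet_lowerCorner u) hlow hL (half_pos hε)
  refine squeeze_zero (fun _ => measureReal_nonneg) (fun n => ?_) (by simpa using h1.add h2)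
  refine (measureReal_mono fun ω hω => ?_).trans (measureReal_union_le _ _)
  have hsum : (√(n : ℝ))⁻¹ * ∑ k ∈ Finset.range n, influence C u (U k ω) =
      √n * (empFreq U (upperCorner u) n ω / survival C (1 - u) (1 - u) -
        empFreq U (lowerCorner u) n ω / C u u) := by
    have hn : (√(n : ℝ))⁻¹ = √n * (1 / n) := by
      rw [mul_one_div, Real.sqrt_div_self', one_div]
    simp only [influence, empFreq]
    rw [Finset.sum_sub_distrib, ← Finset.sum_div, ← Finset.sum_div, hn]
    ring
  by_contra hcon
  simp only [Set.mem_union, Set.mem_ofPred_eq, not_or, not_le, abs_lt] at hcon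
  obtain ⟨⟨h3, h4⟩, h5, h6⟩ := hcon
  change ε ≤ |_| at hω
  refine absurd hω (not_le.2 (abs_lt.2 ?_))
  rw [hsum, finiteAlpha]
  constructor <;> linarith

end

/-- The finite-dimensional distributions of the real-valued version of `𝔸ₙ` converge to those of
the Gaussian process with the covariances of the influence functions. -/
lemma IsIIDSample.tendstoInDistribution_finiteAlpha {Ω : Type*} [MeasurableSpace Ω]
    {P : Measure Ω} [IsProbabilityMeasure P] {C : ℝ → ℝ → ℝ} {U : ℕ → Ω → ℝ × ℝ}
    (hU : IsIIDSample P C U) (hC : IsCopula C) {Q : Measure (indexSet C → ℝ)}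
    [IsProbabilityMeasure Q]
    (hQ : ∀ (s : Finset (indexSet C)) (c : indexSet C → ℝ), Q.map (fun x => ∑ t ∈ s, c t * x t) =
      gaussianReal 0 (‖∑ t ∈ s, c t • (memLp_influence (P := P) (C := C)
        (hU.measurable 0) t.1).toLp‖ ^ 2).toNNReal) (S : Finset (indexSet C)) :
    TendstoInDistribution (fun n ω (u : S) => finiteAlpha C U n u ω) atTop
      (fun x (u : S) => x u) (fun _ => P) Q := by
  have hclt := tendstoInDistribution_inv_sqrt_mul_sum_pi (f := fun u : indexSet C => influence C u)
    hU.measurable hU.indep (hU.identDistrib hC) (fun u => measurable_influence C u)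
    (fun u => memLp_influence (hU.measurable 0) u)
    (fun u => hC.integral_influence (hU.measurable 0) (hU.law 0) u.2) hQ S
  refine tendstoInDistribution_of_tendstoInMeasure_sub _ _ hclt ?_
    fun n => (measurable_pi_lambda (fun ω (u : S) => finiteAlpha C U n u ω) fun u =>
      measurable_finiteAlpha hU.measurable n u).aemeasurable
  rw [tendstoInMeasure_iff_measureReal_norm]
  intro ε hε
  have hlim := tendsto_finsetSum S fun u _ =>
    hU.tendsto_measureReal_finiteAlpha_sub hC u.2 hε
  simp only [Finset.sum_const_zero] at hlim
  refine squeeze_zero (fun _ => measureReal_nonneg) (fun n => ?_) hlim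
  refine (measureReal_mono (fun ω hω => ?_) (measure_ne_top _ _)).trans
    (measureReal_biUnion_finset_le _ _)
  by_contra hcon
  simp only [Set.mem_iUnion, Set.mem_ofPred_eq, not_exists, not_le] at hcon
  change ε ≤ ‖_‖ at hω
  refine absurd hω (not_le.2 ((pi_norm_lt_iff hε).2 fun u => ?_))
  simpa using hcon u u.2

theorem mainTheorem1 {Ω : Type*} [MeasurableSpace Ω] (P : Measure Ω) [IsProbabilityMeasure P]
    (C : ℝ → ℝ → ℝ) (hC : IsCopula C) (U : ℕ → Ω → ℝ × ℝ) (hU : IsIIDSample P C U) :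
    ∃ Q : Measure (indexSet C → ℝ), IsProbabilityMeasure Q ∧
      IsGaussianProcess (fun (u : indexSet C) (x : indexSet C → ℝ) => x u) Q ∧
      (∀ u : indexSet C, ∫ x, x u ∂Q = 0) ∧
      (∀ u v : indexSet C,
        covariance (fun x : indexSet C → ℝ => x u) (fun x => x v) Q = limitCov C u v) ∧
      ConvergesWeakly P (fun n (u : indexSet C) ω => alphaProcess P U n u ω)
        Q (fun (u : indexSet C) x => ((x u : ℝ) : EReal)) := by
  have hL2 (u : indexSet C) := memLp_influence (P := P) (C := C) (hU.measurable 0) u.1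
  obtain ⟨Q, hQp, hQ⟩ := exists_measure_map_sum_eq_gaussianReal fun u => (hL2 u).toLp
  refine ⟨Q, hQp, isGaussianProcess_of_map_sum hQ, fun u => ?_, fun u v => ?_, ?_⟩
  · rw [(hasLaw_eval_of_map_sum hQ u).integral_eq, integral_id_gaussianReal]
  · rw [covariance_eval_of_map_sum hQ, L2.inner_def,
      ← hC.integral_influence_mul (hU.measurable 0) (hU.law 0) u.2 v.2]
    refine integral_congr_ae ?_
    filter_upwards [(hL2 u).coeFn_toLp, (hL2 v).coeFn_toLp] with ω hu hv
    simp [hu, hv, mul_comm]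
  · exact convergesWeakly_of_tendstoInDistribution
      (B := fun n (u : indexSet C) ω => finiteAlpha C U n u ω)
      (fun n u => (measurable_alphaProcess hU.measurable n u).aemeasurable)
      (fun n u => (measurable_finiteAlpha hU.measurable n u).aemeasurable)
      (fun u => (measurable_pi_apply u).aemeasurable)
      (hU.tendstoInDistribution_finiteAlpha hC hQ)
      (fun u => hU.tendsto_measureReal_alphaProcess_ne hC u.2)
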